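/- Let $n\ge 1$, let $\mathbb{B}^n=\{z\in\mathbb{C}^n: |z|<1\}$ be the Euclidean unit ball, and let $\mu$ be Lebesgue measure on $\mathbb{C}^n\cong\mathbb{R}^{2n}$. For $1<p<\infty$, let $\mathbf{b}^p(\mathbb{B}^n)$ be the class of pluriharmonic functions $f:\mathbb{B}^n\to\mathbb{C}$ (that is, $f$ is twice continuously differentiable and $\partial^2 f/\partial z_j\partial\overline{z}_k=0$ for all $j,k$) with $\int_{\mathbb{B}^n}|f|^p\,d\mu<\infty$. Put $$C_1(p)=\sqrt{1-\left|\cos\tfrac{\pi}{p}\right|},\qquad C_2(p)=\sqrt{2}\,\max\left\{\sin\tfrac{\pi}{2p},\ \cos\tfrac{\pi}{2p}\right\}.$$ If $1<p<\infty$, $h$ and $g$ are holomorphic on $\mathbb{B}^n$, $f=h+\overline{g}\in\mathbf{b}^p(\mathbb{B}^n)$ and $\operatorname{Re}(g(0)h(0))=0$, then $(|h|^2+|g|^2)^{p/2}$ is integrable on $\mathbb{B}^n$, $$\left(\int_{\mathbb{B}^n}\big(|h(z)|^2+|g(z)|^2\big)^{p/2}\,d\mu(z)\right)^{1/p}\le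 \frac{1}{C_1(p)}\left(\int_{\mathbb{B}^n}|f(z)|^p\,d\mu(z)\right)^{1/p},$$ and $$\left(\int_{\mathbb{B}^n}|f(z)|^p\,d\mu(z)\right)^{1/p}\le C_2(p)\left(\int_{\mathbb{B}^n}\big(|h(z)|^2+|g(z)|^2\big)^{p/2}\,d\mu(z)\right)^{1/p}.$$ -/

import Mathlib

open MeasureTheory Metric ComplexConjugate

noncomputable section

/-- Complex Euclidean space `ℂⁿ` with its Hermitian norm. -/
abbrev Cn (n : ℕ) : Type := EuclideanSpace ℂ (Fin n)

/-- The open unit ball of `ℂⁿ`. -/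
abbrev unitBall (n : ℕ) : Set (Cn n) := ball 0 1

/-- The Wirtinger derivative `∂f/∂z_j = (∂f/∂x_j - i ∂f/∂y_j) / 2`. -/
def wirtinger {n : ℕ} (j : Fin n) (f : Cn n → ℂ) (z : Cn n) : ℂ :=
  (fderiv ℝ f z (EuclideanSpace.single j 1)
    - Complex.I * fderiv ℝ f z (EuclideanSpace.single j Complex.I)) / 2

/-- The Wirtinger derivative `∂f/∂z̄_k = (∂f/∂x_k + i ∂f/∂y_k) / 2`. -/
def wirtingerBar {n : ℕ} (k : Fin n) (f : Cn n → ℂ) (z : Cn n) : ℂ :=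
  (fderiv ℝ f z (EuclideanSpace.single k 1)
    + Complex.I * fderiv ℝ f z (EuclideanSpace.single k Complex.I)) / 2

/-- `f` is pluriharmonic on the (open) set `D`: it is of class `C²` there in the real sense and
`∂²f/∂z_j∂z̄_k = 0` on `D` for all `j, k`. -/
def IsPluriharmonicOn {n : ℕ} (f : Cn n → ℂ) (D : Set (Cn n)) : Prop :=
  ContDiffOn ℝ 2 f D ∧ ∀ z ∈ D, ∀ j k : Fin n, wirtinger j (wirtingerBar k f) z = 0

/-- The pluriharmonic Bergman class `𝐛ᵖ(𝔹ⁿ)`: pluriharmonic `f` with `∫_{𝔹ⁿ} |f|ᵖ dμ < ∞`,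
where `μ` is the `2n`-dimensional Lebesgue measure. -/
def bergmanClass (n : ℕ) (p : ℝ) : Set (Cn n → ℂ) :=
  {f | IsPluriharmonicOn f (unitBall n) ∧
    IntegrableOn (fun z => ‖f z‖ ^ p) (unitBall n)}

/-- `C₁(p) = √(1 - |cos (π/p)|)`. -/
def rieszC₁ (p : ℝ) : ℝ := √(1 - |Real.cos (Real.pi / p)|)

/-- `C₂(p) = √2 max {sin (π/(2p)), cos (π/(2p))}`. -/
def rieszC₂ (p : ℝ) : ℝ := √2 * max (Real.sin (Real.pi / (2 * p))) (Real.cos (Real.pi / (2 * p)))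

end

/-! Put q = p/2, R = |h|² + |g|² and w = 2gh. Then |f|² = R + Re w, where w is holomorphic, |w| ≤ R
and Re w(0) = 0. Both estimates come from pointwise inequalities (1 - |cos(π/p)|)^q R^q + ψ(w) ≤ (R
+ Re w)^q and (R + Re w)^q + ψ(w) ≤ (1 + |cos(π/p)|)^q R^q, each with its own subharmonic ψ,
nonnegative on the imaginary axis (`exists_support_le_rpow`, `exists_support_rpow_le`). Averaging
over rotations of the ball and using the sub-mean value property on complex lines, the integral of
ψ(w) is nonnegative because ψ(w(0)) ≥ 0, so this term can be dropped.

Each ψ is a positive multiple of `powProfile q (±w)`. The profile does not decrease as |Im w| grows,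
which reduces the inequalities to |w| = R. By homogeneity they become a one-variable extremum
problem, solved at the angle π/(2q), where cos(qt) = 0.

Subharmonicity enters only through local lower supports by real parts of analytic functions;
`HasHarmonicSupport.le_circleAverage` turns these into the sub-mean value property by a maximum
principle. -/

/-! ### One-variable trigonometric inequalities on the circle |w| = R. -/

section CircleInequalities

open Real Set

/-- A continuous function on `[a, b]` whose derivative is nonpositive before `c` and nonnegative
after `c` is minimal at `c`. -/
lemma le_of_deriv_sign_change {f f' : ℝ → ℝ} {a b c : ℝ} (hac : a ≤ c) (hcb : c ≤ b)
    (hf : ContinuousOn f (Icc a b)) (hd : ∀ t ∈ Ioo a b, HasDerivAt f (f' t) t)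
    (h₁ : ∀ t ∈ Ioo a c, f' t ≤ 0) (h₂ : ∀ t ∈ Ioo c b, 0 ≤ f' t) {t : ℝ} (ht : t ∈ Icc a b) :
    f c ≤ f t := by
  rcases le_total t c with htc | htc
  · have : AntitoneOn f (Icc a c) := by
      refine antitoneOn_of_hasDerivWithinAt_nonpos (convex_Icc _ _)
        (hf.mono (Icc_subset_Icc_right hcb)) (f' := f') ?_ ?_
      · intro x hx
        rw [interior_Icc] at hx
        exact (hd x ⟨hx.1, hx.2.trans_le hcb⟩).hasDerivWithinAt
      · intro x hx
        rw [interior_Icc] at hx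
        exact h₁ x hx
    exact this ⟨ht.1, htc⟩ ⟨hac, le_rfl⟩ htc
  · have : MonotoneOn f (Icc c b) := by
      refine monotoneOn_of_hasDerivWithinAt_nonneg (convex_Icc _ _)
        (hf.mono (Icc_subset_Icc_left hac)) (f' := f') ?_ ?_
      · intro x hx
        rw [interior_Icc] at hx
        exact (hd x ⟨hac.trans_lt hx.1, hx.2⟩).hasDerivWithinAt
      · intro x hx
        rw [interior_Icc] at hx
        exact h₂ x hx
    exact this ⟨le_rfl, hcb⟩ ⟨htc, ht.2⟩ htc

variable {q t : ℝ}

/-- For `ε = ±1`, the quotient `(1 + ε cos t) ^ (q - 1) sin t / sin (q t)`. -/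
noncomputable def sinRatio (ε q t : ℝ) : ℝ := (1 + ε * cos t) ^ (q - 1) * sin t / sin (q * t)

lemma one_add_mul_cos_pos {ε : ℝ} (hε : ε ^ 2 = 1) (h0 : 0 < t) (hπ : t < π) :
    0 < 1 + ε * cos t := by
  have h1 : 0 < sin t := sin_pos_of_pos_of_lt_pi h0 hπ
  have h2 := sin_sq_add_cos_sq t
  rcases (by simpa using hε : ε = 1 ∨ ε = -1) with rfl | rfl <;> nlinarith

lemma hasDerivAt_one_add_mul_cos_rpow {ε s : ℝ} (hε : ε ^ 2 = 1) (h0 : 0 < t) (hπ : t < π) :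
    HasDerivAt (fun t => (1 + ε * cos t) ^ s) (-(ε * s * (1 + ε * cos t) ^ (s - 1) * sin t)) t := by
  have h := (((hasDerivAt_cos t).const_mul ε).const_add 1).rpow_const (p := s)
    (Or.inl (one_add_mul_cos_pos hε h0 hπ).ne')
  convert h using 1
  ring

lemma hasDerivAt_sinRatio {ε : ℝ} (hε : ε ^ 2 = 1) (h0 : 0 < t) (hπ : t < π)
    (hs : sin (q * t) ≠ 0) :
    HasDerivAt (sinRatio ε q)
      ((1 + ε * cos t) ^ (q - 1) * (q * sin (q * t - t) - ε * (q - 1) * sin (q * t))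
        / sin (q * t) ^ 2) t := by
  have hpos := one_add_mul_cos_pos hε h0 hπ
  have h1 := (hasDerivAt_one_add_mul_cos_rpow (s := q - 1) hε h0 hπ).mul (hasDerivAt_sin t)
  have h2 : HasDerivAt (fun t => sin (q * t)) (cos (q * t) * (q * 1)) t :=
    ((hasDerivAt_id t).const_mul q).sin
  have h3 := h1.div h2 hs
  refine h3.congr_deriv ?_
  congr 1
  have e : (1 + ε * cos t) ^ (q - 1) = (1 + ε * cos t) ^ (q - 1 - 1) * (1 + ε * cos t) := by
    rw [← rpow_add_one hpos.ne']; ring_nf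
  rw [sin_sub]
  simp only [Pi.mul_apply, e]
  have hsq := sin_sq_add_cos_sq t
  have hs2 : sin t ^ 2 = 1 - cos t ^ 2 := by linarith
  set A := (1 + ε * cos t) ^ (q - 1 - 1)
  linear_combination (A * sin (q * t) * (-(ε * (q - 1)))) * hs2 +
    A * sin (q * t) * (q-1) * cos t * hε


lemma mul_sin_le_sin_mul {l x : ℝ} (hl0 : 0 ≤ l) (hl1 : l ≤ 1) (hx0 : 0 ≤ x) (hxπ : x ≤ π) :
    l * sin x ≤ sin (l * x) := by
  have h := strictConcaveOn_sin_Icc.concaveOn.2 (x := x) (y := 0) ⟨hx0, hxπ⟩ ⟨le_rfl, pi_pos.le⟩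
    hl0 (sub_nonneg.2 hl1) (by ring)
  simpa using h

/-- Concavity of the sine with weight (q - 1)/q at the point qt gives q sin(qt - t) ≥ (q - 1)
sin(qt) ≥ 0, which settles both signs of ε. -/
lemma sinRatio_deriv_sign_nonneg {ε : ℝ} (hε : ε = 1 ∨ ε = -1) (hq : 1 ≤ q) (h0 : 0 < t)
    (hqt : q * t < π) : 0 ≤ q * sin (q * t - t) - ε * (q - 1) * sin (q * t) := by
  have hq0 : 0 < q := by linarith
  have hqt0 : 0 < q * t := by positivity
  have h2 : 0 ≤ sin (q * t) := sin_nonneg_of_nonneg_of_le_pi hqt0.le hqt.le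
  have h : (q - 1) / q * sin (q * t) ≤ sin ((q - 1) / q * (q * t)) :=
    mul_sin_le_sin_mul (div_nonneg (by linarith) hq0.le) ((div_le_one hq0).2 (by linarith))
      hqt0.le hqt.le
  have e : (q - 1) / q * (q * t) = q * t - t := by field_simp
  rw [e, div_mul_eq_mul_div, div_le_iff₀ hq0] at h
  have h3 : 0 ≤ (q - 1) * sin (q * t) := mul_nonneg (by linarith) h2
  rcases hε with rfl | rfl <;> linarith

/-- The same concavity argument with weight (1 - q)/q, which is at most 1 because q > 1/2. -/
lemma sinRatio_deriv_sign_nonpos {ε : ℝ} (hε : ε = 1 ∨ ε = -1) (hq' : 1 / 2 < q) (hq : q ≤ 1)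
    (h0 : 0 < t) (hqt : q * t < π) : q * sin (q * t - t) - ε * (q - 1) * sin (q * t) ≤ 0 := by
  have hq0 : 0 < q := by linarith
  have hqt0 : 0 < q * t := by positivity
  have h2 : 0 ≤ sin (q * t) := sin_nonneg_of_nonneg_of_le_pi hqt0.le hqt.le
  have h : (1 - q) / q * sin (q * t) ≤ sin ((1 - q) / q * (q * t)) :=
    mul_sin_le_sin_mul (div_nonneg (by linarith) hq0.le) ((div_le_one hq0).2 (by linarith))
      hqt0.le hqt.le
  have e : (1 - q) / q * (q * t) = -(q * t - t) := by field_simp; ring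
  rw [e, sin_neg, div_mul_eq_mul_div, div_le_iff₀ hq0] at h
  have h3 : 0 ≤ (1 - q) * sin (q * t) := mul_nonneg (by linarith) h2
  rcases hε with rfl | rfl <;> linarith

lemma sinRatio_domain {b : ℝ} (hbπ : b ≤ π) (hqb : q * b ≤ π) (hq : 0 < q) (ht : t ∈ Ioo 0 b) :
    0 < t ∧ t < π ∧ q * t < π ∧ 0 < sin (q * t) := by
  have h : q * t < π := lt_of_lt_of_le (by have := ht.2; gcongr) hqb
  exact ⟨ht.1, ht.2.trans_le hbπ, h, sin_pos_of_pos_of_lt_pi (mul_pos hq ht.1) h⟩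

lemma monotoneOn_sinRatio {ε b : ℝ} (hε : ε = 1 ∨ ε = -1) (hq : 1 ≤ q) (hbπ : b ≤ π)
    (hqb : q * b ≤ π) : MonotoneOn (sinRatio ε q) (Ioo 0 b) := by
  have hε2 : ε ^ 2 = 1 := by simpa using hε
  have key : ∀ t ∈ Ioo 0 b, HasDerivAt (sinRatio ε q) _ t := fun t ht => by
    obtain ⟨h1, h2, h3, h4⟩ := sinRatio_domain hbπ hqb (by linarith) ht
    exact hasDerivAt_sinRatio hε2 h1 h2 h4.ne'
  refine monotoneOn_of_hasDerivWithinAt_nonneg (convex_Ioo _ _)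
    (fun t ht => (key t ht).continuousAt.continuousWithinAt)
    (fun t ht => (key t (interior_subset ht)).hasDerivWithinAt) fun t ht => ?_
  obtain ⟨h1, h2, h3, h4⟩ := sinRatio_domain hbπ hqb (by linarith) (interior_subset ht)
  exact div_nonneg (mul_nonneg (rpow_nonneg (one_add_mul_cos_pos hε2 h1 h2).le _)
    (sinRatio_deriv_sign_nonneg hε hq h1 h3)) (sq_nonneg _)

lemma antitoneOn_sinRatio {ε b : ℝ} (hε : ε = 1 ∨ ε = -1) (hq' : 1 / 2 < q) (hq : q ≤ 1)
    (hbπ : b ≤ π) (hqb : q * b ≤ π) : AntitoneOn (sinRatio ε q) (Ioo 0 b) := by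
  have hε2 : ε ^ 2 = 1 := by simpa using hε
  have key : ∀ t ∈ Ioo 0 b, HasDerivAt (sinRatio ε q) _ t := fun t ht => by
    obtain ⟨h1, h2, h3, h4⟩ := sinRatio_domain hbπ hqb (by linarith) ht
    exact hasDerivAt_sinRatio hε2 h1 h2 h4.ne'
  refine antitoneOn_of_hasDerivWithinAt_nonpos (convex_Ioo _ _)
    (fun t ht => (key t ht).continuousAt.continuousWithinAt)
    (fun t ht => (key t (interior_subset ht)).hasDerivWithinAt) fun t ht => ?_
  obtain ⟨h1, h2, h3, h4⟩ := sinRatio_domain hbπ hqb (by linarith) (interior_subset ht)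
  exact div_nonpos_of_nonpos_of_nonneg
    (mul_nonpos_of_nonneg_of_nonpos (rpow_nonneg (one_add_mul_cos_pos hε2 h1 h2).le _)
    (sinRatio_deriv_sign_nonpos hε hq' hq h1 h3)) (sq_nonneg _)

/-- The critical angle `π / (2 q)`. -/
noncomputable def critAngle (q : ℝ) : ℝ := π / (2 * q)

lemma mul_critAngle (hq : 0 < q) : q * critAngle q = π / 2 := by
  unfold critAngle; field_simp

lemma critAngle_pos (hq : 0 < q) : 0 < critAngle q := by
  unfold critAngle; positivity

lemma critAngle_lt_pi (hq : 1 / 2 < q) : critAngle q < π := by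
  unfold critAngle
  rw [div_lt_iff₀ (by linarith)]
  nlinarith [pi_pos]

lemma critAngle_mem_Ioo (hq : 1 / 2 < q) : critAngle q ∈ Ioo 0 (min π (π / q)) := by
  have hq0 : 0 < q := by linarith
  refine ⟨critAngle_pos hq0, lt_min (critAngle_lt_pi hq) ?_⟩
  rw [lt_div_iff₀ hq0, mul_comm, mul_critAngle hq0]
  linarith [pi_pos]

/-- The value of `sinRatio ε q` at the critical angle. -/
noncomputable def critCoeff (ε q : ℝ) : ℝ := (1 + ε * cos (critAngle q)) ^ (q - 1) * sin (critAngle q)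

lemma sinRatio_critAngle (ε : ℝ) (hq : 0 < q) : sinRatio ε q (critAngle q) = critCoeff ε q := by
  simp [sinRatio, critCoeff, mul_critAngle hq]

lemma critCoeff_pos {ε : ℝ} (hε : ε = 1 ∨ ε = -1) (hq : 1 / 2 < q) : 0 < critCoeff ε q :=
  have hq0 : 0 < q := by linarith
  mul_pos (rpow_pos_of_pos (one_add_mul_cos_pos (by simpa using hε) (critAngle_pos hq0)
    (critAngle_lt_pi hq)) _) (sin_pos_of_pos_of_lt_pi (critAngle_pos hq0) (critAngle_lt_pi hq))

lemma continuous_one_add_mul_cos_rpow_sub (ε c : ℝ) (hq : 0 < q) :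
    Continuous fun t => (1 + ε * cos t) ^ q - c * cos (q * t) := by
  have : Continuous fun t : ℝ => (1 + ε * cos t) ^ q :=
    Continuous.rpow_const (by fun_prop) fun _ => Or.inr hq.le
  fun_prop

/-- `critCoeff` is the coefficient for which the last factor vanishes at the critical angle;
monotonicity of `sinRatio` then gives the sign of the derivative on either side. -/
lemma hasDerivAt_one_add_mul_cos_rpow_sub {ε b : ℝ} (hε : ε = 1 ∨ ε = -1) (hq : 0 < q)
    (hbπ : b ≤ π) (hqb : q * b ≤ π) (ht : t ∈ Ioo 0 b) :
    HasDerivAt (fun t => (1 + ε * cos t) ^ q - ε * critCoeff ε q * cos (q * t))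
      (ε * (q * sin (q * t) * (critCoeff ε q - sinRatio ε q t))) t := by
  obtain ⟨h1, h2, h3, h4⟩ := sinRatio_domain hbπ hqb hq ht
  have h5 := (hasDerivAt_one_add_mul_cos_rpow (s := q) (by simpa using hε) h1 h2).sub
    ((((hasDerivAt_id t).const_mul q).cos).const_mul (ε * critCoeff ε q))
  refine h5.congr_deriv ?_
  simp only [sinRatio, id]
  field_simp
  ring

/-- For `1/2 < q ≤ 1` the function `ε ((1 + ε cos t) ^ q - ε c cos (q t))` is minimal at the
critical angle. -/
lemma circle_inequality_of_le_one {ε : ℝ} (hε : ε = 1 ∨ ε = -1) (hq' : 1 / 2 < q) (hq : q ≤ 1)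
    (ht : t ∈ Icc 0 π) :
    ε * (1 + ε * cos (critAngle q)) ^ q ≤
      ε * ((1 + ε * cos t) ^ q - ε * critCoeff ε q * cos (q * t)) := by
  have hq0 : 0 < q := by linarith
  have hqb : q * π ≤ π := by nlinarith [pi_pos]
  have hm : critAngle q ∈ Ioo 0 π := ⟨critAngle_pos hq0, critAngle_lt_pi hq'⟩
  have hanti := antitoneOn_sinRatio hε hq' hq le_rfl hqb
  have hεε : ε * ε = 1 := by rcases hε with rfl | rfl <;> norm_num
  have key := le_of_deriv_sign_change
    (f := fun t => ε * ((1 + ε * cos t) ^ q - ε * critCoeff ε q * cos (q * t)))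
    (f' := fun t => q * sin (q * t) * (critCoeff ε q - sinRatio ε q t)) hm.1.le hm.2.le
    ((continuous_one_add_mul_cos_rpow_sub ε _ hq0).const_mul ε).continuousOn
    (fun t ht => ((hasDerivAt_one_add_mul_cos_rpow_sub hε hq0 le_rfl hqb ht).const_mul
      ε).congr_deriv (by rw [← mul_assoc, hεε, one_mul])) ?_ ?_ ht
  · simpa [mul_critAngle hq0] using key
  · intro s hs
    have hs' : s ∈ Ioo 0 π := ⟨hs.1, hs.2.trans hm.2⟩
    obtain ⟨h1, h2, h3, h4⟩ := sinRatio_domain le_rfl hqb hq0 hs'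
    have h5 := hanti hs' hm hs.2.le
    rw [sinRatio_critAngle ε hq0] at h5
    exact mul_nonpos_of_nonneg_of_nonpos (mul_pos hq0 h4).le (by linarith)
  · intro s hs
    have hs' : s ∈ Ioo 0 π := ⟨hm.1.trans hs.1, hs.2⟩
    obtain ⟨h1, h2, h3, h4⟩ := sinRatio_domain le_rfl hqb hq0 hs'
    have h5 := hanti hm hs' hs.1.le
    rw [sinRatio_critAngle ε hq0] at h5
    exact mul_nonneg (mul_pos hq0 h4).le (by linarith)

/-- For `1 ≤ q` the function `ε ((1 + ε cos t) ^ q - ε c cos (min (q t) π))` is maximal at the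
critical angle. -/
lemma circle_inequality_of_one_le {ε : ℝ} (hε : ε = 1 ∨ ε = -1) (hq : 1 ≤ q)
    (ht : t ∈ Icc 0 π) :
    ε * ((1 + ε * cos t) ^ q - ε * critCoeff ε q * cos (min (q * t) π)) ≤
      ε * (1 + ε * cos (critAngle q)) ^ q := by
  have hq0 : 0 < q := by linarith
  have hb : π / q ≤ π := div_le_self pi_pos.le hq
  have hqb : q * (π / q) ≤ π := by field_simp; rfl
  have hm : critAngle q ∈ Ioo 0 (π / q) := by
    simpa [min_eq_right hb] using critAngle_mem_Ioo (q := q) (by linarith)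
  have hmono := monotoneOn_sinRatio hε hq hb hqb
  have hεε : ε * ε = 1 := by rcases hε with rfl | rfl <;> norm_num
  have key : ∀ t ∈ Icc 0 (π / q), ε * ((1 + ε * cos t) ^ q - ε * critCoeff ε q * cos (q * t)) ≤
      ε * (1 + ε * cos (critAngle q)) ^ q := by
    intro t ht
    have key := le_of_deriv_sign_change
      (f := fun t => -(ε * ((1 + ε * cos t) ^ q - ε * critCoeff ε q * cos (q * t))))
      (f' := fun t => -(q * sin (q * t) * (critCoeff ε q - sinRatio ε q t))) hm.1.le hm.2.le
      ((continuous_one_add_mul_cos_rpow_sub ε _ hq0).const_mul ε).neg.continuousOn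
      (fun t ht => ((hasDerivAt_one_add_mul_cos_rpow_sub hε hq0 hb hqb ht).const_mul
        ε).neg.congr_deriv (by rw [← mul_assoc, hεε, one_mul])) ?_ ?_ ht
    · simpa [mul_critAngle hq0] using key
    · intro s hs
      have hs' : s ∈ Ioo 0 (π / q) := ⟨hs.1, hs.2.trans hm.2⟩
      obtain ⟨h1, h2, h3, h4⟩ := sinRatio_domain hb hqb hq0 hs'
      have h5 := hmono hs' hm hs.2.le
      rw [sinRatio_critAngle ε hq0] at h5
      exact neg_nonpos.2 (mul_nonneg (mul_pos hq0 h4).le (by linarith))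
    · intro s hs
      have hs' : s ∈ Ioo 0 (π / q) := ⟨hm.1.trans hs.1, hs.2⟩
      obtain ⟨h1, h2, h3, h4⟩ := sinRatio_domain hb hqb hq0 hs'
      have h5 := hmono hm hs' hs.1.le
      rw [sinRatio_critAngle ε hq0] at h5
      exact neg_nonneg.2 (mul_nonpos_of_nonneg_of_nonpos (mul_pos hq0 h4).le (by linarith))
  rcases le_total t (π / q) with h | h
  · rw [min_eq_left (by rwa [le_div_iff₀' hq0] at h)]
    exact key t ⟨ht.1, h⟩
  · rw [min_eq_right (by rwa [div_le_iff₀' hq0] at h)]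
    -- Beyond π/q the cosine is frozen at -1, while ε(1 + ε cos t)^q decreases in t for either sign,
    -- so the endpoint π/q is the worst case.
    refine le_trans ?_ (key (π / q) ⟨by positivity, le_rfl⟩)
    have hcos : cos t ≤ cos (π / q) := cos_le_cos_of_nonneg_of_le_pi (by positivity) ht.2 h
    rw [mul_div_cancel₀ _ hq0.ne']
    rcases hε with rfl | rfl
    · have : (1 + 1 * cos t) ^ q ≤ (1 + 1 * cos (π / q)) ^ q :=
        rpow_le_rpow (by linarith [neg_one_le_cos t]) (by linarith) hq0.le
      linarith
    · have : (1 + -1 * cos (π / q)) ^ q ≤ (1 + -1 * cos t) ^ q :=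
        rpow_le_rpow (by linarith [cos_le_one (π / q)]) (by linarith) hq0.le
      linarith

end CircleInequalities

/-! ### The subharmonic profile and the two pointwise inequalities. -/

section PowProfile

open Real Set Filter Topology

/-- The function is continuous and, at every point other than the origin, it is touched from below
by the real part of an analytic function. -/
def HasHarmonicSupport (ψ : ℂ → ℝ) : Prop :=
  Continuous ψ ∧ ∀ w₀ : ℂ, w₀ ≠ 0 → ∃ b : ℂ → ℂ, AnalyticAt ℂ b w₀ ∧ (b w₀).re = ψ w₀ ∧
    ∀ᶠ w in 𝓝 w₀, (b w).re ≤ ψ w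

lemma HasHarmonicSupport.const_mul {ψ : ℂ → ℝ} (h : HasHarmonicSupport ψ) {c : ℝ} (hc : 0 ≤ c) :
    HasHarmonicSupport fun w => c * ψ w := by
  refine ⟨h.1.const_mul c, fun w₀ hw₀ => ?_⟩
  obtain ⟨b, hb, hb0, hle⟩ := h.2 w₀ hw₀
  refine ⟨fun w => c * b w, analyticAt_const.mul hb, by simp [hb0], ?_⟩
  filter_upwards [hle] with w hw
  simpa using mul_le_mul_of_nonneg_left hw hc

lemma HasHarmonicSupport.comp_mul_left {ψ : ℂ → ℝ} (h : HasHarmonicSupport ψ) {a : ℂ}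
    (ha : a ≠ 0) : HasHarmonicSupport fun w => ψ (a * w) := by
  refine ⟨h.1.comp (continuous_const_mul a), fun w₀ hw₀ => ?_⟩
  obtain ⟨b, hb, hb0, hle⟩ := h.2 (a * w₀) (mul_ne_zero ha hw₀)
  refine ⟨fun w => b (a * w), ?_, hb0, ?_⟩
  · exact AnalyticAt.fun_comp hb (analyticAt_const.mul analyticAt_id)
  · exact (continuous_const_mul a).continuousAt.eventually hle

/-- The sign `1` for `q ≤ 1` and `-1` for `q > 1`. -/
noncomputable def profileSign (q : ℝ) : ℝ := if q ≤ 1 then 1 else -1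

/-- The `q`-homogeneous subharmonic function `± ‖w‖ ^ q cos (min (q |arg w|) π)`. -/
noncomputable def powProfile (q : ℝ) (w : ℂ) : ℝ :=
  profileSign q * (‖w‖ ^ q * cos (min (q * |w.arg|) π))

variable {q : ℝ}

lemma profileSign_eq_or (q : ℝ) : profileSign q = 1 ∨ profileSign q = -1 := by
  unfold profileSign; split_ifs <;> simp

lemma powProfile_of_le_one (hq : q ≤ 1) (w : ℂ) : powProfile q w = ‖w‖ ^ q * cos (q * w.arg) := by
  have h : q * |w.arg| ≤ π := by
    nlinarith [abs_nonneg w.arg, Complex.abs_arg_le_pi w]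
  rw [powProfile, profileSign, if_pos hq, one_mul, min_eq_left h]
  congr 1
  rcases abs_choice w.arg with h | h <;> rw [h]
  rw [mul_neg, cos_neg]

lemma powProfile_of_one_lt (hq : 1 < q) (w : ℂ) :
    powProfile q w = -(‖w‖ ^ q * cos (min (q * |w.arg|) π)) := by
  rw [powProfile, profileSign, if_neg (by linarith), neg_one_mul]

lemma continuousAt_abs_arg {w : ℂ} (hw : w ≠ 0) : ContinuousAt (fun z : ℂ => |z.arg|) w := by
  have h : ContinuousAt (fun z : ℂ => InnerProductGeometry.angle 1 z) w :=
    (InnerProductGeometry.continuousAt_angle (x := ((1 : ℂ), w)) one_ne_zero hw).comp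
      (f := fun z : ℂ => ((1 : ℂ), z)) (by fun_prop)
  refine h.congr ?_
  filter_upwards [isOpen_ne.mem_nhds hw] with z hz
  exact Complex.angle_one_left hz

lemma continuous_powProfile (hq : 0 < q) : Continuous (powProfile q) := by
  rw [continuous_iff_continuousAt]
  intro w
  have hn : Continuous fun z : ℂ => ‖z‖ ^ q := continuous_norm.rpow_const fun _ => Or.inr hq.le
  rcases eq_or_ne w 0 with rfl | hw
  · have h0 : powProfile q 0 = 0 := by simp [powProfile, hq.ne']
    rw [ContinuousAt, h0]
    refine squeeze_zero_norm (a := fun z : ℂ => ‖z‖ ^ q) (fun z => ?_) ?_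
    · rw [powProfile, norm_mul, norm_mul]
      have h1 : ‖profileSign q‖ = 1 := by rcases profileSign_eq_or q with h | h <;> simp [h]
      have h2 : ‖cos (min (q * |z.arg|) π)‖ ≤ 1 := abs_cos_le_one _
      have h3 : ‖‖z‖ ^ q‖ = ‖z‖ ^ q := by simp [abs_of_nonneg, rpow_nonneg]
      rw [h1, h3, one_mul]
      exact mul_le_of_le_one_right (by positivity) h2
    · have := hn.tendsto 0
      simpa [hq.ne'] using this
  · have h := continuousAt_abs_arg hw
    have h2 : ContinuousAt (fun z : ℂ => cos (min (q * |z.arg|) π)) w :=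
      continuous_cos.continuousAt.comp ((h.const_mul q).min continuousAt_const)
    exact (hn.continuousAt.mul h2).const_mul _

lemma powProfile_nonneg_of_re_eq_zero (hq : 0 ≤ q) {w : ℂ} (hw : w.re = 0) :
    0 ≤ powProfile q w := by
  rcases eq_or_ne w 0 with rfl | hw0
  · rcases hq.eq_or_lt with rfl | hq
    · simp [powProfile, profileSign, pi_pos.le]
    · simp [powProfile, hq.ne']
  have harg : |w.arg| = π / 2 := by
    have him : w.im ≠ 0 := fun h => hw0 (Complex.ext hw h)
    refine le_antisymm (Complex.abs_arg_le_pi_div_two_iff.2 hw.ge) ?_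
    by_contra! h
    rw [Complex.abs_arg_lt_pi_div_two_iff] at h
    rcases h with h | h
    · linarith
    · exact hw0 h
  rcases le_or_gt q 1 with h | h
  · rw [powProfile, profileSign, if_pos h, one_mul, harg]
    refine mul_nonneg (by positivity) (cos_nonneg_of_neg_pi_div_two_le_of_le ?_ ?_)
    · have : 0 ≤ min (q * (π / 2)) π := le_min (by positivity) pi_pos.le
      linarith [pi_pos]
    · exact (min_le_left _ _).trans (by nlinarith [pi_pos])
  · rw [powProfile_of_one_lt h, harg, neg_nonneg]
    refine mul_nonpos_of_nonneg_of_nonpos (by positivity)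
      (cos_nonpos_of_pi_div_two_le_of_le (le_min ?_ ?_) ?_)
    · nlinarith [pi_pos]
    · linarith [pi_pos]
    · exact (min_le_right _ _).trans (by linarith [pi_pos])

lemma hasHarmonicSupport_powProfile (hq0 : 0 < q) : HasHarmonicSupport (powProfile q) := by
  refine ⟨continuous_powProfile hq0, fun w₀ hw₀ => ?_⟩
  have hcpow : ∀ {a : ℂ}, a * w₀ ∈ Complex.slitPlane → AnalyticAt ℂ (fun w => (a * w) ^ (q : ℂ)) w₀ :=
    fun ha => (analyticAt_const.mul analyticAt_id).cpow analyticAt_const ha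
  rcases le_or_gt q 1 with hq | hq
  · by_cases hs : w₀ ∈ Complex.slitPlane
    · refine ⟨fun w => (1 * w) ^ (q : ℂ), hcpow (by simpa), ?_, .of_forall fun w => ?_⟩ <;>
      simp [Complex.cpow_ofReal_re, powProfile_of_le_one hq, mul_comm]
    · have him : w₀.im = 0 := by
        by_contra h
        exact hs (Or.inr h)
      have hre : w₀.re < 0 := by
        have h1 : w₀.re ≤ 0 := not_lt.1 fun h => hs (Or.inl h)
        exact h1.lt_of_ne fun h => hw₀ (Complex.ext h him)
      -- On the negative axis the support continues the branch from the upper half-plane. Below the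
      -- axis it falls short of the profile by a product of two nonnegative sines.
      have key : ∀ w : ℂ, (Complex.exp ((π * q : ℝ) * Complex.I) * (-1 * w) ^ (q : ℂ)).re =
          ‖w‖ ^ q * cos (π * q + (-w).arg * q) := by
        intro w
        rw [neg_one_mul, Complex.mul_re, Complex.exp_ofReal_mul_I_re, Complex.exp_ofReal_mul_I_im,
          Complex.cpow_ofReal_re, Complex.cpow_ofReal_im, norm_neg, cos_add]
        ring
      refine ⟨fun w => Complex.exp ((π * q : ℝ) * Complex.I) * (-1 * w) ^ (q : ℂ),
        analyticAt_const.mul (hcpow (Or.inl (by simpa using hre))), ?_, ?_⟩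
      · have e1 : w₀.arg = π := Complex.arg_eq_pi_iff.2 ⟨hre, him⟩
        have e2 : (-w₀).arg = 0 := Complex.arg_eq_zero_iff.2 ⟨by simpa using hre.le, by simpa⟩
        rw [key, powProfile_of_le_one hq, e1, e2]
        ring_nf
      · filter_upwards [(isOpen_lt Complex.continuous_re continuous_const).mem_nhds hre] with w hw
        change w.re < 0 at hw
        rw [key, powProfile_of_le_one hq]
        refine mul_le_mul_of_nonneg_left ?_ (by positivity)
        rcases lt_trichotomy w.im 0 with h | h | h
        · rw [Complex.arg_neg_eq_arg_add_pi_of_im_neg h]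
          have h1 := Complex.neg_pi_lt_arg w
          have h2 := Complex.arg_neg_iff.2 h
          have : cos (q * w.arg) - cos (π * q + (w.arg + π) * q) =
              2 * sin (q * π) * sin (q * (π + w.arg)) := by
            rw [cos_sub_cos]
            have e1 : (q * w.arg + (π * q + (w.arg + π) * q)) / 2 = q * (π + w.arg) := by ring
            have e2 : (q * w.arg - (π * q + (w.arg + π) * q)) / 2 = -(q * π) := by ring
            rw [e1, e2, sin_neg]; ring
          have h3 : 0 ≤ sin (q * π) :=
            sin_nonneg_of_nonneg_of_le_pi (by positivity) (by nlinarith [pi_pos])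
          have h4 : 0 ≤ sin (q * (π + w.arg)) :=
            sin_nonneg_of_nonneg_of_le_pi (mul_nonneg hq0.le (by linarith)) (by nlinarith [pi_pos])
          have := mul_nonneg h3 h4
          linarith
        · have e1 : w.arg = π := Complex.arg_eq_pi_iff.2 ⟨hw, h⟩
          have e2 : (-w).arg = 0 := Complex.arg_eq_zero_iff.2 ⟨by simpa using hw.le, by simpa⟩
          rw [e1, e2]
          ring_nf
          rfl
        · rw [Complex.arg_neg_eq_arg_sub_pi_of_im_pos h]
          ring_nf
          rfl
  · rcases le_or_gt (q * |w₀.arg|) π with h | h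
    · have hs : w₀ ∈ Complex.slitPlane := by
        rw [Complex.mem_slitPlane_iff_arg]
        refine ⟨fun e => ?_, hw₀⟩
        rw [e, abs_of_pos pi_pos] at h
        nlinarith [pi_pos]
      have habs : ∀ w : ℂ, cos (w.arg * q) = cos (q * |w.arg|) := by
        intro w
        rcases abs_choice w.arg with h | h <;> rw [h, mul_comm]
        rw [mul_neg, cos_neg]
      -- Re(-w^q) supports the profile from below on the whole plane: where the angle is frozen, the
      -- profile takes the largest value that -cos allows.
      refine ⟨fun w => -(1 * w) ^ (q : ℂ), (hcpow (by simpa)).neg, ?_, .of_forall fun w => ?_⟩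
      · simp [Complex.cpow_ofReal_re, powProfile_of_one_lt hq, min_eq_left h, habs]
      · simp only [one_mul, Complex.neg_re, Complex.cpow_ofReal_re, powProfile_of_one_lt hq, habs,
          neg_le_neg_iff]
        refine mul_le_mul_of_nonneg_left ?_ (by positivity)
        rcases le_total (q * |w.arg|) π with h | h
        · rw [min_eq_left h]
        · rw [min_eq_right h, cos_pi]
          exact neg_one_le_cos _
    -- Here the profile is locally |w|^q, and |w₀|^q Re (w/w₀)^q lies below it with equality at w₀.
    · refine ⟨fun w => (‖w₀‖ ^ q : ℝ) * (w₀⁻¹ * w) ^ (q : ℂ),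
        analyticAt_const.mul (hcpow (by simp [hw₀])), ?_, ?_⟩
      · rw [powProfile_of_one_lt hq, min_eq_right h.le]
        simp [hw₀]
      · filter_upwards [((continuousAt_abs_arg hw₀).const_mul q).eventually (lt_mem_nhds h)]
          with w hw
        rw [powProfile_of_one_lt hq, min_eq_right hw.le, Complex.re_ofReal_mul,
          Complex.cpow_ofReal_re, cos_pi, norm_mul, norm_inv, mul_rpow (by positivity)
          (by positivity), inv_rpow (by positivity)]
        have hp : 0 < ‖w₀‖ ^ q := rpow_pos_of_pos (norm_pos_iff.2 hw₀) q
        rw [← mul_assoc, ← mul_assoc, mul_inv_cancel₀ hp.ne', one_mul, mul_neg_one, neg_neg]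
        exact mul_le_of_le_one_right (by positivity) (cos_le_one _)


/-- Freezing at π keeps the function differentiable because sin π = 0, so no exceptional ray arises
in the vertical derivative of the profile. -/
lemma hasDerivAt_cos_min_pi (u : ℝ) :
    HasDerivAt (fun u => cos (min u π)) (-sin (min u π)) u := by
  rcases lt_trichotomy u π with h | rfl | h
  · rw [min_eq_left h.le]
    refine (hasDerivAt_cos u).congr_of_eventuallyEq ?_
    filter_upwards [gt_mem_nhds h] with v hv
    rw [min_eq_left hv.le]
  · rw [min_self, ← hasDerivWithinAt_univ, ← Iic_union_Ici (a := π)]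
    refine HasDerivWithinAt.union ?_ ?_
    · refine (hasDerivAt_cos π).hasDerivWithinAt.congr (fun v hv => ?_) (by simp)
      rw [min_eq_left hv]
    · rw [sin_pi, neg_zero]
      refine (hasDerivWithinAt_const π (Ici π) (cos π)).congr (fun v hv => ?_) (by simp)
      rw [min_eq_right hv]
  · rw [min_eq_right h.le, sin_pi, neg_zero]
    refine (hasDerivAt_const u (cos π)).congr_of_eventuallyEq ?_
    filter_upwards [lt_mem_nhds h] with v hv
    rw [min_eq_right hv.le]

lemma powProfile_conj (q : ℝ) (w : ℂ) : powProfile q (conj w) = powProfile q w := by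
  have : |(conj w).arg| = |w.arg| := by
    rw [Complex.arg_conj]
    split_ifs with h
    · rw [h]
    · rw [abs_neg]
  rw [powProfile, powProfile, this, Complex.norm_conj]

/-- With L = log w the profile is, up to sign, exp(q Re L) cos(min(q Im L, π)), and the vertical
derivative of L is i/w. -/
lemma hasDerivAt_powProfile_vertical (q : ℝ) {w : ℂ} (hw : 0 < w.im) :
    HasDerivAt (fun y : ℝ => powProfile q ⟨w.re, y⟩)
      (profileSign q * (q * ‖w‖ ^ (q - 1) * sin (w.arg - min (q * w.arg) π))) w.im := by
  have hl : HasDerivAt (fun y : ℝ => Complex.log (w.re + y * Complex.I)) (Complex.I / w) w.im := by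
    have h1 : HasDerivAt (fun y : ℝ => (w.re + y * Complex.I : ℂ)) Complex.I w.im := by
      simpa using ((Complex.ofRealCLM.hasDerivAt (x := w.im)).mul_const Complex.I).const_add
        (w.re : ℂ)
    have h2 := h1.clog_real (Or.inr (by simpa using hw.ne'))
    rwa [Complex.re_add_im] at h2
  have hre := Complex.reCLM.hasFDerivAt.comp_hasDerivAt w.im hl
  have him := Complex.imCLM.hasFDerivAt.comp_hasDerivAt w.im hl
  have h1 := ((hre.const_mul q).exp.mul
    ((hasDerivAt_cos_min_pi _).comp w.im (him.const_mul q))).const_mul (profileSign q)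
  have hw0 : w ≠ 0 := fun h => by simp [h] at hw
  have hnorm : 0 < ‖w‖ := norm_pos_iff.2 hw0
  refine (h1.congr_of_eventuallyEq ?_).congr_deriv ?_
  · filter_upwards [lt_mem_nhds hw] with y hy
    have hz : (w.re + y * Complex.I : ℂ) = ⟨w.re, y⟩ := by apply Complex.ext <;> simp
    have hz0 : (⟨w.re, y⟩ : ℂ) ≠ 0 := fun h => hy.ne' (congrArg Complex.im h)
    have harg : 0 ≤ (⟨w.re, y⟩ : ℂ).arg := Complex.arg_nonneg_iff.2 hy.le
    simp only [powProfile, Pi.mul_apply, Function.comp_apply, Complex.reCLM_apply,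
      Complex.imCLM_apply, hz, Complex.log_re, Complex.log_im]
    rw [rpow_def_of_pos (norm_pos_iff.2 hz0), abs_of_nonneg harg, mul_comm (log _)]
  · simp only [Function.comp_apply, Complex.reCLM_apply,
      Complex.imCLM_apply, Complex.re_add_im, Complex.log_re, Complex.log_im]
    rw [mul_comm q (log _), ← rpow_def_of_pos hnorm, sin_sub, Complex.sin_arg,
      Complex.cos_arg hw0, Complex.div_re, Complex.div_im, Complex.normSq_eq_norm_sq,
      rpow_sub_one hnorm.ne']
    simp only [Complex.I_re, Complex.I_im, zero_mul, zero_div, one_mul, zero_add, sub_zero]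
    field_simp
    ring

lemma powProfile_vertical_mono (hq : 0 < q) {w w' : ℂ} (hre : w.re = w'.re)
    (him : |w.im| ≤ |w'.im|) : powProfile q w ≤ powProfile q w' := by
  have key : ∀ x : ℝ, MonotoneOn (fun y : ℝ => powProfile q ⟨x, y⟩) (Ici 0) := by
    intro x
    have hc : Continuous fun y : ℝ => (⟨x, y⟩ : ℂ) := by
      have : (fun y : ℝ => (⟨x, y⟩ : ℂ)) = fun y : ℝ => (x + y * Complex.I : ℂ) := by
        ext y; apply Complex.ext <;> simp
      rw [this]; fun_prop
    refine monotoneOn_of_hasDerivWithinAt_nonneg (convex_Ici 0)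
      ((continuous_powProfile hq).comp hc).continuousOn
      (f' := fun y => profileSign q * (q * ‖(⟨x, y⟩ : ℂ)‖ ^ (q - 1) *
        sin ((⟨x, y⟩ : ℂ).arg - min (q * (⟨x, y⟩ : ℂ).arg) π)))
      (fun y hy => ?_) (fun y hy => ?_)
    · rw [interior_Ici] at hy
      exact (hasDerivAt_powProfile_vertical q (w := ⟨x, y⟩) hy).hasDerivWithinAt
    · rw [interior_Ici] at hy
      set t := (⟨x, y⟩ : ℂ).arg
      have ht0 : 0 ≤ t := Complex.arg_nonneg_iff.2 (le_of_lt hy)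
      have htπ : t ≤ π := Complex.arg_le_pi _
      rw [mul_left_comm]
      refine mul_nonneg (by positivity) ?_
      have hqt : 0 ≤ q * t := by positivity
      -- The difference between t and min(qt, π) has modulus at most π, and its sign matches
      -- `profileSign`.
      rcases le_or_gt q 1 with h | h
      · rw [profileSign, if_pos h, one_mul]
        refine sin_nonneg_of_nonneg_of_le_pi (sub_nonneg.2 ((min_le_left _ _).trans ?_)) ?_
        · nlinarith
        · linarith [le_min hqt pi_pos.le]
      · rw [profileSign, if_neg h.not_ge, neg_one_mul, ← sin_neg, neg_sub]
        refine sin_nonneg_of_nonneg_of_le_pi (sub_nonneg.2 (le_min ?_ htπ)) ?_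
        · nlinarith
        · linarith [min_le_right (q * t) π]
  have habs : ∀ z : ℂ, powProfile q z = powProfile q ⟨z.re, |z.im|⟩ := by
    intro z
    rcases abs_choice z.im with h | h
    · rw [h]
    · rw [h, ← powProfile_conj]
      congr 1
  rw [habs w, habs w', hre]
  exact key _ (mem_Ici.2 (abs_nonneg _)) (mem_Ici.2 (abs_nonneg _)) him

/-- With t = |arg(εw)| one has |w| + Re w = |w|(1 + ε cos t), so this is the circle inequality
scaled by |w|^q. -/
lemma powProfile_circle_inequality {ε : ℝ} (hε : ε = 1 ∨ ε = -1) (hq : 1 / 2 < q) (w : ℂ) :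
    profileSign q * ε * ((1 + ε * cos (critAngle q)) ^ q * ‖w‖ ^ q) +
      critCoeff ε q * powProfile q (ε * w) ≤ profileSign q * ε * (‖w‖ + w.re) ^ q := by
  have hq0 : 0 < q := by linarith
  rcases eq_or_ne w 0 with rfl | hw
  · simp [powProfile, hq0.ne']
  have hn : 0 < ‖w‖ := norm_pos_iff.2 hw
  have hεw : (ε : ℂ) * w ≠ 0 := by rcases hε with rfl | rfl <;> simpa
  have hnorm : ‖(ε : ℂ) * w‖ = ‖w‖ := by rcases hε with rfl | rfl <;> simp
  set t := |((ε : ℂ) * w).arg| with ht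
  have htmem : t ∈ Icc 0 π := ⟨abs_nonneg _, Complex.abs_arg_le_pi _⟩
  have hεε : ε * ε = 1 := by rcases hε with rfl | rfl <;> norm_num
  have hcos : ‖w‖ * (1 + ε * cos t) = ‖w‖ + w.re := by
    rw [ht, cos_abs, Complex.cos_arg hεw, hnorm, Complex.re_ofReal_mul]
    field_simp
    linear_combination w.re * hεε
  have hge : 0 ≤ 1 + ε * cos t := by
    have h1 := cos_le_one t
    have h2 := neg_one_le_cos t
    rcases hε with rfl | rfl <;> linarith
  rw [← hcos, mul_rpow hn.le hge, powProfile, hnorm, ← ht]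
  have hnq : 0 ≤ ‖w‖ ^ q := by positivity
  rcases le_or_gt q 1 with h | h
  · have key := mul_le_mul_of_nonneg_left (circle_inequality_of_le_one hε hq h htmem) hnq
    have hm : q * t ≤ π := by nlinarith [htmem.1, htmem.2]
    rw [profileSign, if_pos h, min_eq_left hm]
    linear_combination key - ‖w‖ ^ q * critCoeff ε q * cos (q * t) * hεε
  · have key := mul_le_mul_of_nonneg_left (circle_inequality_of_one_le hε h.le htmem) hnq
    rw [profileSign, if_neg h.not_ge]
    linear_combination key + ‖w‖ ^ q * critCoeff ε q * cos (min (q * t) π) * hεε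

/-- Moving w vertically to the circle of radius R leaves R + Re w unchanged and does not decrease
the profile. -/
lemma powProfile_inequality {ε : ℝ} (hε : ε = 1 ∨ ε = -1) (hq : 1 / 2 < q) {w : ℂ} {R : ℝ}
    (hR : ‖w‖ ≤ R) :
    profileSign q * ε * ((1 + ε * cos (critAngle q)) ^ q * R ^ q) +
      critCoeff ε q * powProfile q (ε * w) ≤ profileSign q * ε * (R + w.re) ^ q := by
  have hR0 : 0 ≤ R := (norm_nonneg w).trans hR
  have hsq : ‖w‖ ^ 2 = w.re ^ 2 + w.im ^ 2 := by
    rw [← Complex.normSq_eq_norm_sq, Complex.normSq_apply]; ring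
  have hle : ‖w‖ ^ 2 ≤ R ^ 2 := by gcongr
  set w' : ℂ := ⟨w.re, √(R ^ 2 - w.re ^ 2)⟩ with hw'
  have hsqrt : √(R ^ 2 - w.re ^ 2) ^ 2 = R ^ 2 - w.re ^ 2 := sq_sqrt (by nlinarith [sq_nonneg w.im])
  have hnorm : ‖w'‖ = R := by
    have : ‖w'‖ ^ 2 = R ^ 2 := by
      rw [← Complex.normSq_eq_norm_sq, Complex.normSq_apply]
      simp only [hw']
      linarith
    exact (pow_left_inj₀ (norm_nonneg _) hR0 two_ne_zero).1 this
  have hmono : powProfile q (ε * w) ≤ powProfile q (ε * w') := by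
    refine powProfile_vertical_mono (by linarith) (by simp [hw']) ?_
    simp only [Complex.im_ofReal_mul, abs_mul]
    refine mul_le_mul_of_nonneg_left ?_ (abs_nonneg _)
    simp only [hw']
    exact sq_le_sq.1 (by rw [hsqrt]; linarith)
  have h := powProfile_circle_inequality hε hq w'
  rw [hnorm] at h
  have := mul_le_mul_of_nonneg_left hmono (critCoeff_pos hε hq).le
  simp only [hw'] at h this ⊢
  linarith

/-- The critical angle is at least π/2 for q ≤ 1 and below π/2 for q > 1; this produces the absolute
value in both constants. -/
lemma profileSign_mul_cos_critAngle (hq : 1 / 2 < q) :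
    profileSign q * cos (critAngle q) = -|cos (critAngle q)| := by
  have hq0 : 0 < q := by linarith
  rcases le_or_gt q 1 with h | h
  · have : cos (critAngle q) ≤ 0 := by
      refine cos_nonpos_of_pi_div_two_le_of_le ?_ (by linarith [critAngle_lt_pi hq, pi_pos])
      have := mul_critAngle hq0
      nlinarith [critAngle_pos hq0]
    rw [profileSign, if_pos h, abs_of_nonpos this]; ring
  · have : 0 ≤ cos (critAngle q) := by
      refine cos_nonneg_of_neg_pi_div_two_le_of_le (by linarith [critAngle_pos hq0, pi_pos]) ?_
      have := mul_critAngle hq0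
      nlinarith [critAngle_pos hq0]
    rw [profileSign, if_neg h.not_ge, abs_of_nonneg this]; ring

theorem exists_support_le_rpow (hq : 1 / 2 < q) :
    ∃ ψ : ℂ → ℝ, HasHarmonicSupport ψ ∧ (∀ w : ℂ, w.re = 0 → 0 ≤ ψ w) ∧
      ∀ (R : ℝ) (w : ℂ), ‖w‖ ≤ R →
        (1 - |cos (critAngle q)|) ^ q * R ^ q + ψ w ≤ (R + w.re) ^ q := by
  have hq0 : 0 < q := by linarith
  have hε := profileSign_eq_or q
  have hc := (critCoeff_pos hε hq).le
  -- Taking ε equal to the profile sign makes the prefactor +1; the opposite choice reverses the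
  -- inequality and gives the upper bound.
  refine ⟨fun w => critCoeff (profileSign q) q * powProfile q ((profileSign q : ℝ) * w),
    ((hasHarmonicSupport_powProfile hq0).comp_mul_left ?_).const_mul hc, fun w hw => ?_,
    fun R w hR => ?_⟩
  · rcases hε with h | h <;> simp [h]
  · exact mul_nonneg hc (powProfile_nonneg_of_re_eq_zero hq0.le (by simp [hw]))
  · have h := powProfile_inequality hε hq hR
    have hs : profileSign q * profileSign q = 1 := by rcases hε with h | h <;> simp [h]
    rwa [hs, one_mul, one_mul, profileSign_mul_cos_critAngle hq, ← sub_eq_add_neg] at h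

theorem exists_support_rpow_le (hq : 1 / 2 < q) :
    ∃ ψ : ℂ → ℝ, HasHarmonicSupport ψ ∧ (∀ w : ℂ, w.re = 0 → 0 ≤ ψ w) ∧
      ∀ (R : ℝ) (w : ℂ), ‖w‖ ≤ R →
        (R + w.re) ^ q + ψ w ≤ (1 + |cos (critAngle q)|) ^ q * R ^ q := by
  have hq0 : 0 < q := by linarith
  have hε : -profileSign q = 1 ∨ -profileSign q = -1 := by
    rcases profileSign_eq_or q with h | h <;> simp [h]
  have hc := (critCoeff_pos hε hq).le
  refine ⟨fun w => critCoeff (-profileSign q) q * powProfile q ((-profileSign q : ℝ) * w),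
    ((hasHarmonicSupport_powProfile hq0).comp_mul_left ?_).const_mul hc, fun w hw => ?_,
    fun R w hR => ?_⟩
  · rcases hε with h | h <;> simp [h]
  · exact mul_nonneg hc (powProfile_nonneg_of_re_eq_zero hq0.le (by simp [hw]))
  · have h := powProfile_inequality hε hq hR
    have hs : profileSign q * -profileSign q = -1 := by
      rcases profileSign_eq_or q with h | h <;> simp [h]
    rw [hs, neg_mul (profileSign q), profileSign_mul_cos_critAngle hq, neg_neg] at h
    linarith

end PowProfile

/-! ### From local supports to the sub-mean value property. -/

section SubmeanValue

open Real Set Filter Topology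

/-- Real continuous functions on the unit circle are uniform limits of real parts of entire
functions. -/
lemma exists_entire_re_approx {u : ℂ → ℝ} (hu : ContinuousOn u (sphere 0 1)) {ε : ℝ}
    (hε : 0 < ε) :
    ∃ P : ℂ → ℂ, Differentiable ℂ P ∧ ∀ z ∈ sphere (0 : ℂ) 1, |u z - (P z).re| ≤ ε := by
  have hcont : Continuous fun x : UnitAddCircle => ((u (AddCircle.toCircle x) : ℝ) : ℂ) := by
    refine Complex.continuous_ofReal.comp (hu.comp_continuous ?_ fun x => ?_)
    · exact continuous_subtype_val.comp AddCircle.continuous_toCircle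
    · exact mem_sphere_zero_iff_norm.2 (Circle.norm_coe _)
  set f : C(UnitAddCircle, ℂ) := ⟨_, hcont⟩ with hf
  have hmem : f ∈ closure (Submodule.span ℂ (range (@fourier 1)) : Set C(UnitAddCircle, ℂ)) := by
    rw [← Submodule.topologicalClosure_coe, span_fourier_closure_eq_top]
    trivial
  obtain ⟨g, hg, hfg⟩ := Metric.mem_closure_iff.1 hmem ε hε
  have key : ∃ P Q : ℂ → ℂ, Differentiable ℂ P ∧ Differentiable ℂ Q ∧ ∀ x : UnitAddCircle,
      g x = P (AddCircle.toCircle x) + conj (Q (AddCircle.toCircle x)) := by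
    clear hfg
    refine Submodule.span_induction ?_ ?_ ?_ ?_ hg
    · rintro _ ⟨n, rfl⟩
      rcases Int.eq_nat_or_neg n with ⟨k, rfl | rfl⟩
      · refine ⟨fun z => z ^ k, fun _ => 0, by fun_prop, by fun_prop, fun x => ?_⟩
        simp [fourier_apply, AddCircle.toCircle_nsmul]
      · refine ⟨fun _ => 0, fun z => z ^ k, by fun_prop, by fun_prop, fun x => ?_⟩
        rw [fourier_neg]
        simp [fourier_apply, AddCircle.toCircle_nsmul]
    · exact ⟨fun _ => 0, fun _ => 0, by fun_prop, by fun_prop, by simp⟩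
    · rintro a b - - ⟨P, Q, hP, hQ, h⟩ ⟨P', Q', hP', hQ', h'⟩
      refine ⟨P + P', Q + Q', hP.add hP', hQ.add hQ', fun x => ?_⟩
      simp only [ContinuousMap.add_apply, h, h', Pi.add_apply, map_add]
      ring
    · rintro c a - ⟨P, Q, hP, hQ, h⟩
      refine ⟨c • P, conj c • Q, hP.const_smul c, hQ.const_smul _, fun x => ?_⟩
      simp only [ContinuousMap.smul_apply, h, Pi.smul_apply, smul_eq_mul, map_mul,
        Complex.conj_conj]
      ring
  obtain ⟨P, Q, hP, hQ, h⟩ := key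
  -- Conjugation does not change real parts, so the antiholomorphic part may be replaced by Q.
  refine ⟨P + Q, hP.add hQ, fun z hz => ?_⟩
  obtain ⟨x, hx⟩ := (AddCircle.homeomorphCircle (T := 1) one_ne_zero).surjective
    ⟨z, by simpa [Submonoid.unitSphere] using hz⟩
  rw [AddCircle.homeomorphCircle_apply] at hx
  have hxz : (AddCircle.toCircle x : ℂ) = z := by rw [hx]
  have h1 : ‖f x - g x‖ ≤ ε := by
    rw [← dist_eq_norm]
    exact (ContinuousMap.dist_apply_le_dist x).trans hfg.le
  refine le_trans ?_ ((Complex.abs_re_le_norm _).trans h1)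
  rw [h x, hf]
  simp [hxz]

/-- Maximum principle: a continuous function on a compact set which at each point is either
nonpositive or bounded by its mean over some circle in the set is nonpositive. -/
lemma nonpos_of_le_circleAverage {K : Set ℂ} (hK : IsCompact K) {v : ℂ → ℝ}
    (hv : ContinuousOn v K)
    (h : ∀ z ∈ K, v z ≤ 0 ∨ ∃ r > 0, sphere z r ⊆ K ∧ v z ≤ circleAverage v z r) :
    ∀ z ∈ K, v z ≤ 0 := by
  intro z hz
  obtain ⟨z₀, hz₀, hmax⟩ := hK.exists_isMaxOn ⟨z, hz⟩ hv
  refine (hmax hz).trans ?_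
  by_contra! hpos
  have hS : IsCompact (K ∩ v ⁻¹' Ici (v z₀)) :=
    hK.of_isClosed_subset (hv.preimage_isClosed_of_isClosed hK.isClosed isClosed_Ici)
      inter_subset_left
  -- Among the maximum points, take one farthest from the origin.
  obtain ⟨z₁, ⟨hz₁, hv₁⟩, hmax₁⟩ := hS.exists_isMaxOn ⟨z₀, hz₀, mem_preimage.2 self_mem_Ici⟩
    continuous_norm.continuousOn
  have hv₁ : v z₀ ≤ v z₁ := hv₁
  rcases h z₁ hz₁ with h1 | ⟨r, hr, hsub, havg⟩
  · linarith
  -- Starting the circle in the outward radial direction, its first point has modulus |z₁| + r, so v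
  -- is not maximal there and the mean is strictly smaller.
  rw [circleAverage_eq_integral_add z₁.arg] at havg
  have hmap : ∀ θ : ℝ, circleMap z₁ r θ ∈ K := fun θ => hsub (circleMap_mem_sphere _ hr.le _)
  have hc : Continuous fun θ : ℝ => v (circleMap z₁ r (θ + z₁.arg)) :=
    hv.comp_continuous ((continuous_circleMap _ _).comp (continuous_add_const _)) fun θ => hmap _
  have hlt : v (circleMap z₁ r (0 + z₁.arg)) < v z₀ := by
    by_contra! hge
    have h2 : ‖circleMap z₁ r (0 + z₁.arg)‖ ≤ ‖z₁‖ := hmax₁ ⟨hmap _, hge⟩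
    have h3 : circleMap z₁ r (0 + z₁.arg) = ((‖z₁‖ + r : ℝ) : ℂ) * Complex.exp (z₁.arg * Complex.I) := by
      rw [circleMap, zero_add]
      nth_rewrite 1 [← Complex.norm_mul_exp_arg_mul_I z₁]
      push_cast
      ring
    rw [h3, norm_mul, Complex.norm_exp_ofReal_mul_I, mul_one, Complex.norm_real, norm_eq_abs,
      abs_of_nonneg (by positivity)] at h2
    linarith
  have hint : ∫ θ in (0)..(2 * π), v (circleMap z₁ r (θ + z₁.arg)) < ∫ _ in (0)..(2 * π), v z₀ :=
    intervalIntegral.integral_lt_integral_of_continuousOn_of_le_of_exists_lt (by positivity)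
      hc.continuousOn continuousOn_const (fun θ _ => hmax (hmap _))
      ⟨0, ⟨le_rfl, by positivity⟩, hlt⟩
  rw [intervalIntegral.integral_const, sub_zero, smul_eq_mul] at hint
  rw [smul_eq_mul, ← div_eq_inv_mul, le_div_iff₀ (by positivity)] at havg
  nlinarith [pi_pos]

lemma circleAverage_re_eq {H : ℂ → ℂ} {z : ℂ} {r : ℝ} (hr : 0 ≤ r)
    (hH : AnalyticOnNhd ℂ H (closedBall z r)) :
    circleAverage (fun ζ => (H ζ).re) z r = (H z).re := by
  have hd : DifferentiableOn ℂ H (closedBall z |r|) := by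
    rw [abs_of_nonneg hr]; exact hH.differentiableOn
  have h1 : circleAverage H z r = H z := (hd.diffContOnCl_ball subset_rfl).circleAverage
  have h2 := Complex.reCLM.circleAverage_comp_comm (f := H) (c := z) (R := r)
    (ContinuousOn.circleIntegrable hr (hH.continuousOn.mono sphere_subset_closedBall))
  rw [h1] at h2
  exact h2

/-- The maximum principle is applied to ψ(F) - Re P + ε(log|F| - log M₀). The logarithmic term is
nonpositive and tends to -∞ at the zeros of F, where no support is available; finally ε → 0. -/
lemma HasHarmonicSupport.le_re_of_le_on_circle {ψ : ℂ → ℝ} (hψ : HasHarmonicSupport ψ)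
    {F P : ℂ → ℂ} (hF : AnalyticOnNhd ℂ F (closedBall 0 1)) (hP : Differentiable ℂ P)
    (hle : ∀ z ∈ sphere (0 : ℂ) 1, ψ (F z) ≤ (P z).re) (h0 : F 0 ≠ 0) :
    ψ (F 0) ≤ (P 0).re := by
  have hcompact : IsCompact (closedBall (0 : ℂ) 1) := isCompact_closedBall _ _
  have hFc := hF.continuousOn
  have hdiff : ContinuousOn (fun z => ψ (F z) - (P z).re) (closedBall 0 1) :=
    (hψ.1.comp_continuousOn hFc).sub (Complex.continuous_re.comp hP.continuous).continuousOn
  obtain ⟨M₀, hM₀⟩ := hcompact.exists_bound_of_continuousOn hFc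
  obtain ⟨C, hC⟩ := hcompact.exists_bound_of_continuousOn hdiff
  have hz0 : (0 : ℂ) ∈ closedBall (0 : ℂ) 1 := by simp
  have hM : 0 < M₀ := (norm_pos_iff.2 h0).trans_le (hM₀ 0 hz0)
  have main : ∀ ε > 0, ψ (F 0) - (P 0).re + ε * (log ‖F 0‖ - log M₀) ≤ 0 := by
    intro ε hε
    -- Where |F| ≤ δ, the logarithmic term is at most -C and beats the bound C on ψ(F) - Re P; the
    -- minimum with |F(0)| keeps 0 in K.
    set δ := min ‖F 0‖ (M₀ * exp (-C / ε)) with hδ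
    have hδ0 : 0 < δ := lt_min (norm_pos_iff.2 h0) (by positivity)
    have hlogδ : C + ε * (log δ - log M₀) ≤ 0 := by
      have h1 : log δ ≤ log M₀ + -C / ε := by
        rw [← log_exp (-C / ε), ← log_mul hM.ne' (exp_pos _).ne']
        exact log_le_log hδ0 (min_le_right _ _)
      have h2 : ε * (log δ - log M₀) ≤ ε * (-C / ε) := by gcongr; linarith
      rw [mul_div_cancel₀ _ hε.ne'] at h2
      linarith
    set K := closedBall (0 : ℂ) 1 ∩ {z | δ ≤ ‖F z‖} with hKdef
    have hK : IsCompact K := hcompact.of_isClosed_subset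
      (hFc.norm.preimage_isClosed_of_isClosed isClosed_closedBall isClosed_Ici) inter_subset_left
    set v : ℂ → ℝ := fun z => ψ (F z) - (P z).re + ε * (log ‖F z‖ - log M₀) with hvdef
    have hv : ContinuousOn v K := by
      have hlog : ContinuousOn (fun z => log ‖F z‖) K :=
        (hFc.mono inter_subset_left).norm.log fun z hz => (hδ0.trans_le hz.2).ne'
      exact (hdiff.mono inter_subset_left).add
        (continuousOn_const.mul (hlog.sub continuousOn_const))
    refine nonpos_of_le_circleAverage hK hv (fun z hz => ?_) 0
      ⟨hz0, mem_ofPred.2 (min_le_left _ _)⟩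
    have hFz : 0 < ‖F z‖ := hδ0.trans_le hz.2
    rcases eq_or_ne ‖z‖ 1 with hz1 | hz1
    · left
      have h1 := hle z (by simpa using hz1)
      have h2 : log ‖F z‖ ≤ log M₀ := log_le_log hFz (hM₀ z hz.1)
      have h3 : ε * (log ‖F z‖ - log M₀) ≤ 0 :=
        mul_nonpos_of_nonneg_of_nonpos hε.le (by linarith)
      simp only [hvdef]
      linarith
    rcases le_or_gt ‖F z‖ δ with hz2 | hz2
    · left
      have h1 := (le_abs_self _).trans (hC z hz.1)
      have h2 : ε * (log ‖F z‖ - log M₀) ≤ ε * (log δ - log M₀) := by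
        have := log_le_log hFz hz2
        gcongr
      simp only [hvdef]
      linarith
    right
    have hFz0 : F z ≠ 0 := norm_pos_iff.1 hFz
    obtain ⟨b, hb, hbz, hble⟩ := hψ.2 (F z) hFz0
    have hFa : AnalyticAt ℂ F z := hF z hz.1
    -- Re H touches v from below at z; the quotient F ζ / F z is 1 at z, which keeps the logarithm
    -- analytic there.
    set H : ℂ → ℂ := fun ζ => b (F ζ) - P ζ + ε * Complex.log (F ζ / F z) +
      (ε * (log ‖F z‖ - log M₀) : ℝ) with hH
    have hHa : AnalyticAt ℂ H z := by
      refine (((AnalyticAt.fun_comp hb hFa).sub (hP.analyticAt z)).add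
        (analyticAt_const.mul ((hFa.div analyticAt_const hFz0).clog ?_))).add analyticAt_const
      simp [hFz0]
    have hHre : ∀ ζ, F ζ ≠ 0 → (H ζ).re = (b (F ζ)).re - (P ζ).re + ε * (log ‖F ζ‖ - log M₀) := by
      intro ζ hζ
      simp only [hH, Complex.add_re, Complex.sub_re, Complex.re_ofReal_mul, Complex.log_re,
        norm_div, Complex.ofReal_re]
      rw [log_div (norm_ne_zero_iff.2 hζ) hFz.ne']
      ring
    have hz3 : z ∈ ball (0 : ℂ) 1 := by
      have := hz.1
      simp only [mem_closedBall_zero_iff, mem_ball_zero_iff] at this ⊢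
      exact lt_of_le_of_ne this hz1
    have hev : ∀ᶠ ζ in 𝓝 z, AnalyticAt ℂ H ζ ∧ ζ ∈ ball (0 : ℂ) 1 ∧ δ < ‖F ζ‖ ∧
        (b (F ζ)).re ≤ ψ (F ζ) :=
      hHa.eventually_analyticAt.and ((isOpen_ball.eventually_mem hz3).and
        ((hFa.continuousAt.norm.eventually (lt_mem_nhds hz2)).and
          (hFa.continuousAt.eventually hble)))
    obtain ⟨r, hr, hsub⟩ := nhds_basis_closedBall.eventually_iff.1 hev
    have hsphere : sphere z r ⊆ K := fun ζ hζ =>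
      have h := hsub (sphere_subset_closedBall hζ)
      ⟨ball_subset_closedBall h.2.1, h.2.2.1.le⟩
    have hHan : AnalyticOnNhd ℂ H (closedBall z r) := fun ζ hζ => (hsub hζ).1
    refine ⟨r, hr, hsphere, ?_⟩
    have hvz : v z = (H z).re := by rw [hHre z hFz0, hbz]
    rw [hvz, ← circleAverage_re_eq hr.le hHan]
    refine circleAverage_mono (ContinuousOn.circleIntegrable hr.le
      (Complex.continuous_re.comp_continuousOn (hHan.continuousOn.mono sphere_subset_closedBall)))
      (ContinuousOn.circleIntegrable hr.le (hv.mono hsphere)) fun ζ hζ => ?_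
    rw [abs_of_pos hr] at hζ
    have h := hsub (sphere_subset_closedBall hζ)
    rw [hHre ζ (norm_pos_iff.1 (hδ0.trans h.2.2.1))]
    simp only [hvdef]
    linarith [h.2.2.2]
  have hlim : Tendsto (fun ε : ℝ => ψ (F 0) - (P 0).re + ε * (log ‖F 0‖ - log M₀)) (𝓝[>] 0)
      (𝓝 (ψ (F 0) - (P 0).re + 0 * (log ‖F 0‖ - log M₀))) :=
    (Continuous.tendsto (by fun_prop) 0).mono_left nhdsWithin_le_nhds
  have := le_of_tendsto hlim (eventually_mem_nhdsWithin.mono main)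
  linarith

/-- Approximating ψ(F) + η/2 within η/2 yields ψ(F) ≤ Re P ≤ ψ(F) + η on the circle, and Re P has
the mean value property. -/
lemma HasHarmonicSupport.le_circleAverage_of_ne_zero {ψ : ℂ → ℝ} (hψ : HasHarmonicSupport ψ)
    {F : ℂ → ℂ} (hF : AnalyticOnNhd ℂ F (closedBall 0 1)) (h0 : F 0 ≠ 0) :
    ψ (F 0) ≤ circleAverage (fun z => ψ (F z)) 0 1 := by
  have hc : ContinuousOn (fun z => ψ (F z)) (sphere 0 1) :=
    hψ.1.comp_continuousOn (hF.continuousOn.mono sphere_subset_closedBall)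
  have hci : CircleIntegrable (fun z => ψ (F z)) 0 1 := hc.circleIntegrable zero_le_one
  refine le_of_forall_pos_le_add fun η hη => ?_
  obtain ⟨P, hP, happrox⟩ := exists_entire_re_approx (u := fun z => ψ (F z) + η / 2)
    (hc.add continuousOn_const) (half_pos hη)
  have h1 := hψ.le_re_of_le_on_circle hF hP
    (fun z hz => by have := (abs_le.1 (happrox z hz)).2; linarith) h0
  have hPa : AnalyticOnNhd ℂ P (closedBall 0 1) := fun z _ => hP.analyticAt z
  rw [← circleAverage_re_eq zero_le_one hPa] at h1
  refine h1.trans ?_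
  have h2 : circleAverage (fun z => ψ (F z) + η) 0 1 = circleAverage (fun z => ψ (F z)) 0 1 + η := by
    rw [circleAverage_fun_add hci (circleIntegrable_const η 0 1), circleAverage_const]
  rw [← h2]
  refine circleAverage_mono ((Complex.continuous_re.comp
    hP.continuous).continuousOn.circleIntegrable zero_le_one)
    (hci.add (circleIntegrable_const η 0 1)) fun z hz => ?_
  rw [abs_one] at hz
  have := (abs_le.1 (happrox z hz)).1
  linarith

/-- Sub-mean value property of `ψ ∘ F` for analytic `F`. -/
theorem HasHarmonicSupport.le_circleAverage {ψ : ℂ → ℝ} (hψ : HasHarmonicSupport ψ)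
    {F : ℂ → ℂ} (hF : AnalyticOnNhd ℂ F (closedBall 0 1)) :
    ψ (F 0) ≤ circleAverage (fun z => ψ (F z)) 0 1 := by
  by_cases h0 : F 0 ≠ 0
  · exact hψ.le_circleAverage_of_ne_zero hF h0
  push Not at h0
  have hFc : Continuous fun θ : ℝ => F (circleMap 0 1 θ) :=
    hF.continuousOn.comp_continuous (continuous_circleMap _ _) fun θ =>
      sphere_subset_closedBall (circleMap_mem_sphere _ zero_le_one _)
  have hr : Continuous fun δ : ℝ => circleAverage (fun z => ψ (F z + δ)) 0 1 := by
    simp only [circleAverage_def]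
    refine Continuous.const_smul
      (intervalIntegral.continuous_parametric_intervalIntegral_of_continuous' (μ := volume)
        (f := fun (δ θ : ℝ) => ψ (F (circleMap 0 1 θ) + δ)) ?_ _ _) ((2 * π)⁻¹)
    exact hψ.1.comp ((hFc.comp continuous_snd).add (Complex.continuous_ofReal.comp continuous_fst))
  have hl : Continuous fun δ : ℝ => ψ (F 0 + δ) :=
    hψ.1.comp (continuous_const.add Complex.continuous_ofReal)
  -- When F(0) = 0, translate F by δ > 0 and let δ → 0, using continuity of both sides.
  have h1 : ∀ δ ∈ Ioi (0 : ℝ), ψ (F 0 + δ) ≤ circleAverage (fun z => ψ (F z + δ)) 0 1 := by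
    intro δ hδ
    refine hψ.le_circleAverage_of_ne_zero (F := fun z => F z + δ)
      (fun z hz => (hF z hz).add analyticAt_const) ?_
    rw [h0, zero_add]
    exact_mod_cast (ne_of_gt hδ)
  have h2 := le_of_tendsto_of_tendsto ((hl.tendsto 0).mono_left nhdsWithin_le_nhds)
    ((hr.tendsto 0).mono_left nhdsWithin_le_nhds) (eventually_mem_nhdsWithin.mono h1 :
      ∀ᶠ δ : ℝ in 𝓝[>] 0, _)
  simpa using h2

end SubmeanValue

/-! ### Integration over balls by rotation averaging. -/

section Integration

open Real Set Filter Topology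

variable {n : ℕ}

/-- Multiplication by a unimodular scalar, as a real linear isometry of `ℂⁿ`. -/
noncomputable def rotationIsometry (n : ℕ) (c : ℂ) (hc : ‖c‖ = 1) : Cn n ≃ₗᵢ[ℝ] Cn n where
  toLinearEquiv := (LinearEquiv.smulOfNeZero ℂ (Cn n) c
    (norm_ne_zero_iff.1 (by rw [hc]; exact one_ne_zero))).restrictScalars ℝ
  norm_map' z := by
    change ‖c • z‖ = ‖z‖
    rw [norm_smul, hc, one_mul]

lemma setIntegral_closedBall_smul (u : Cn n → ℝ) {c : ℂ} (hc : ‖c‖ = 1) (r : ℝ) :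
    ∫ z in closedBall (0 : Cn n) r, u (c • z) = ∫ z in closedBall (0 : Cn n) r, u z := by
  have h := (rotationIsometry n c hc).measurePreserving.setIntegral_preimage_emb
    (rotationIsometry n c hc).toHomeomorph.measurableEmbedding u (closedBall 0 r)
  rw [← h]
  have : (rotationIsometry n c hc) ⁻¹' closedBall 0 r = closedBall 0 r := by
    ext z
    simp
  rw [this]
  rfl

/-- The integral is unchanged under z ↦ e^{iθ}z. Averaging in θ and exchanging integrals leaves
circle means of ψ(G(ζz)), each at least ψ(G(0)). -/
lemma setIntegral_comp_nonneg {ψ : ℂ → ℝ} (hψ : HasHarmonicSupport ψ) {G : Cn n → ℂ}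
    (hG : DifferentiableOn ℂ G (unitBall n)) (h0 : 0 ≤ ψ (G 0)) {r : ℝ} (hr : r < 1) :
    0 ≤ ∫ z in closedBall (0 : Cn n) r, ψ (G z) := by
  set I := ∫ z in closedBall (0 : Cn n) r, ψ (G z) with hI
  have hnorm : ∀ (θ : ℝ) (z : Cn n), ‖circleMap 0 1 θ • z‖ = ‖z‖ := fun θ z => by
    rw [norm_smul, norm_circleMap_zero, abs_one, one_mul]
  have hint : Integrable (Function.uncurry fun (θ : ℝ) (z : Cn n) => ψ (G (circleMap 0 1 θ • z)))
      ((volume.restrict (Ioc 0 (2 * π))).prod (volume.restrict (closedBall (0 : Cn n) r))) := by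
    rw [Measure.prod_restrict]
    have hc : ContinuousOn
        (Function.uncurry fun (θ : ℝ) (z : Cn n) => ψ (G (circleMap 0 1 θ • z)))
        (Icc 0 (2 * π) ×ˢ closedBall (0 : Cn n) r) := by
      refine hψ.1.comp_continuousOn (hG.continuousOn.comp (Continuous.continuousOn ?_) ?_)
      · exact ((continuous_circleMap 0 1).comp continuous_fst).smul continuous_snd
      · rintro ⟨θ, z⟩ ⟨-, hz⟩
        rw [mem_closedBall_zero_iff] at hz
        rw [mem_ball_zero_iff, hnorm]
        exact lt_of_le_of_lt hz hr
    exact (hc.integrableOn_compact (isCompact_Icc.prod (isCompact_closedBall _ _))).mono_set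
      (prod_mono Ioc_subset_Icc_self subset_rfl)
  have hswap := integral_integral_swap hint
  have hleft : ∀ θ : ℝ, ∫ z in closedBall (0 : Cn n) r, ψ (G (circleMap 0 1 θ • z)) = I := fun θ =>
    setIntegral_closedBall_smul (fun z => ψ (G z)) (by simp) r
  simp only [hleft] at hswap
  rw [← intervalIntegral.integral_of_le (by positivity), intervalIntegral.integral_const, sub_zero,
    smul_eq_mul] at hswap
  have hright : 0 ≤ ∫ z in closedBall (0 : Cn n) r, ∫ θ in Ioc 0 (2 * π),
      ψ (G (circleMap 0 1 θ • z)) := by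
    refine setIntegral_nonneg measurableSet_closedBall fun z hz => ?_
    rw [← intervalIntegral.integral_of_le (by positivity)]
    have hF : AnalyticOnNhd ℂ (fun ζ : ℂ => G (ζ • z)) (closedBall 0 1) := by
      have hopen : IsOpen {ζ : ℂ | ζ • z ∈ unitBall n} :=
        isOpen_ball.preimage (continuous_id.smul continuous_const)
      have hd : DifferentiableOn ℂ (fun ζ : ℂ => G (ζ • z)) {ζ : ℂ | ζ • z ∈ unitBall n} :=
        hG.comp (by fun_prop) fun ζ hζ => hζ
      refine (hd.analyticOnNhd hopen).mono fun ζ hζ => ?_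
      rw [mem_closedBall_zero_iff] at hz hζ
      rw [mem_ofPred, mem_ball_zero_iff, norm_smul]
      exact (mul_le_of_le_one_left (norm_nonneg z) hζ).trans_lt (hz.trans_lt hr)
    have h1 := hψ.le_circleAverage hF
    rw [zero_smul, circleAverage_def, smul_eq_mul] at h1
    have h2 : 0 < (2 * π)⁻¹ := by positivity
    exact nonneg_of_mul_nonneg_right (h0.trans h1) h2
  rw [← hswap] at hright
  exact nonneg_of_mul_nonneg_right hright (by positivity)

lemma aecover_closedBall_unitBall (n : ℕ) :
    AECover (volume.restrict (unitBall n)) atTop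
      fun k : ℕ => closedBall (0 : Cn n) (1 - 1 / ((k : ℝ) + 1)) := by
  refine ⟨?_, fun k => measurableSet_closedBall⟩
  refine (ae_restrict_iff' measurableSet_ball).2 (.of_forall fun z hz => ?_)
  rw [mem_ball_zero_iff] at hz
  have h : Tendsto (fun k : ℕ => 1 - 1 / ((k : ℝ) + 1)) atTop (𝓝 (1 - 0)) :=
    tendsto_one_div_add_atTop_nhds_zero_nat.const_sub 1
  rw [sub_zero] at h
  filter_upwards [h.eventually (lt_mem_nhds hz)] with k hk
  simpa using hk.le

lemma integrableOn_and_integral_le_of_closedBall {A B : Cn n → ℝ}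
    (hA : ContinuousOn A (unitBall n)) (hA0 : ∀ z, 0 ≤ A z) (hB0 : ∀ z, 0 ≤ B z)
    (hB : IntegrableOn B (unitBall n))
    (hle : ∀ r < 1, ∫ z in closedBall (0 : Cn n) r, A z ≤ ∫ z in closedBall (0 : Cn n) r, B z) :
    IntegrableOn A (unitBall n) ∧ ∫ z in unitBall n, A z ≤ ∫ z in unitBall n, B z := by
  have hcov := aecover_closedBall_unitBall n
  have hlt : ∀ k : ℕ, 1 - 1 / ((k : ℝ) + 1) < 1 := fun k => by
    have : 0 < 1 / ((k : ℝ) + 1) := by positivity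
    linarith
  have hsub : ∀ k : ℕ, closedBall (0 : Cn n) (1 - 1 / ((k : ℝ) + 1)) ⊆ unitBall n := fun k =>
    closedBall_subset_ball (hlt k)
  have hres : ∀ k : ℕ, (volume.restrict (unitBall n)).restrict
      (closedBall (0 : Cn n) (1 - 1 / ((k : ℝ) + 1))) =
      volume.restrict (closedBall (0 : Cn n) (1 - 1 / ((k : ℝ) + 1))) := fun k =>
    Measure.restrict_restrict_of_subset (hsub k)
  have hbound : ∀ k : ℕ, ∫ z in closedBall (0 : Cn n) (1 - 1 / ((k : ℝ) + 1)), A z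
      ∂(volume.restrict (unitBall n)) ≤ ∫ z in unitBall n, B z := fun k => by
    rw [hres]
    exact (hle _ (hlt k)).trans (setIntegral_mono_set hB (.of_forall hB0) (hsub k).eventuallyLE)
  have hAint : IntegrableOn A (unitBall n) :=
    hcov.integrable_of_integral_bounded_of_nonneg_ae _ (fun k => by
      rw [IntegrableOn, hres]
      exact (hA.mono (hsub k)).integrableOn_compact (isCompact_closedBall _ _))
      (.of_forall hA0) (.of_forall hbound)
  exact ⟨hAint, le_of_tendsto' (hcov.integral_tendsto_of_countably_generated hAint) hbound⟩

/-- The comparison is made on smaller closed balls, where ψ(G) is continuous and hence integrable;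
its integrability on the whole ball is never needed. -/
lemma integrableOn_and_integral_le_of_add_support_le {A B : Cn n → ℝ} {ψ : ℂ → ℝ} {G : Cn n → ℂ}
    (hψ : HasHarmonicSupport ψ) (hG : DifferentiableOn ℂ G (unitBall n)) (h0 : 0 ≤ ψ (G 0))
    (hA : ContinuousOn A (unitBall n)) (hA0 : ∀ z, 0 ≤ A z) (hB0 : ∀ z, 0 ≤ B z)
    (hB : IntegrableOn B (unitBall n)) (hle : ∀ z, A z + ψ (G z) ≤ B z) :
    IntegrableOn A (unitBall n) ∧ ∫ z in unitBall n, A z ≤ ∫ z in unitBall n, B z := by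
  refine integrableOn_and_integral_le_of_closedBall hA hA0 hB0 hB fun r hr => ?_
  have hsub : closedBall (0 : Cn n) r ⊆ unitBall n := closedBall_subset_ball hr
  have hcpt : IsCompact (closedBall (0 : Cn n) r) := isCompact_closedBall _ _
  have h1 : IntegrableOn A (closedBall (0 : Cn n) r) := (hA.mono hsub).integrableOn_compact hcpt
  have h2 : IntegrableOn (fun z => ψ (G z)) (closedBall (0 : Cn n) r) :=
    (hψ.1.comp_continuousOn (hG.continuousOn.mono hsub)).integrableOn_compact hcpt
  have h3 := setIntegral_mono (h1.add h2) (hB.mono_set hsub) hle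
  have h4 : ∫ z in closedBall (0 : Cn n) r, (A + fun z => ψ (G z)) z =
      (∫ z in closedBall (0 : Cn n) r, A z) + ∫ z in closedBall (0 : Cn n) r, ψ (G z) :=
    integral_add h1 h2
  have h5 := setIntegral_comp_nonneg hψ hG h0 hr
  linarith

end Integration

/-! ### The constants in terms of |cos(π/p)|. -/

section RieszConstants

open Real

variable {p : ℝ}

lemma abs_cos_pi_div_lt_one (hp : 1 < p) : |cos (π / p)| < 1 := by
  have h0 : 0 < π / p := by positivity
  have h1 : π / p < π := div_lt_self pi_pos hp
  have h2 : 0 < sin (π / p) := sin_pos_of_pos_of_lt_pi h0 h1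
  have h3 := sin_sq_add_cos_sq (π / p)
  rw [← sq_lt_one_iff_abs_lt_one]
  nlinarith

lemma rieszC₁_pos (hp : 1 < p) : 0 < rieszC₁ p :=
  sqrt_pos.2 (sub_pos.2 (abs_cos_pi_div_lt_one hp))

/-- With a = π/(2p), the double-angle formula gives 2 max(sin² a, cos² a) = 1 + |cos 2a|. -/
lemma rieszC₂_eq (hp : 1 < p) : rieszC₂ p = √(1 + |cos (π / p)|) := by
  have ha0 : 0 < π / (2 * p) := by positivity
  have ha1 : π / (2 * p) < π / 2 := by
    rw [div_lt_div_iff_of_pos_left pi_pos (by positivity) (by positivity)]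
    linarith
  have hc : 0 < cos (π / (2 * p)) := cos_pos_of_mem_Ioo ⟨by linarith, ha1⟩
  have hs : 0 < sin (π / (2 * p)) := sin_pos_of_pos_of_lt_pi ha0 (by linarith [pi_pos])
  have e : π / p = 2 * (π / (2 * p)) := by field_simp
  have hm : 0 ≤ max (sin (π / (2 * p))) (cos (π / (2 * p))) := le_max_of_le_left hs.le
  rw [rieszC₂, e, cos_two_mul]
  set a := π / (2 * p)
  have hsq := sin_sq_add_cos_sq a
  have key : 1 + |2 * cos a ^ 2 - 1| = 2 * max (sin a) (cos a) ^ 2 := by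
    rcases le_total (sin a) (cos a) with h | h
    · rw [max_eq_right h, abs_of_nonneg (by nlinarith)]
      ring
    · rw [max_eq_left h, abs_of_nonpos (by nlinarith)]
      linarith
  rw [key, sqrt_mul zero_le_two, sqrt_sq hm]

lemma sqrt_rpow_eq {x : ℝ} (hx : 0 ≤ x) (p : ℝ) : √x ^ p = x ^ (p / 2) := by
  rw [sqrt_eq_rpow, ← rpow_mul hx]
  ring_nf

end RieszConstants

/-! ### Reduction to R and w, and the main theorem. -/

lemma norm_add_conj_rpow (a b : ℂ) (p : ℝ) :
    ‖a + conj b‖ ^ p = (‖a‖ ^ 2 + ‖b‖ ^ 2 + (2 * (b * a)).re) ^ (p / 2) := by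
  have h : ‖a‖ ^ 2 + ‖b‖ ^ 2 + (2 * (b * a)).re = ‖a + conj b‖ ^ 2 := by
    simp only [← Complex.normSq_eq_norm_sq, Complex.normSq_apply, Complex.add_re, Complex.add_im,
      Complex.conj_re, Complex.conj_im, Complex.mul_re, Complex.mul_im, Complex.re_ofNat,
      Complex.im_ofNat]
    ring
  rw [h, ← Real.rpow_natCast, ← Real.rpow_mul (norm_nonneg _)]
  congr 1
  push_cast
  ring

lemma norm_two_mul_le (a b : ℂ) : ‖2 * (b * a)‖ ≤ ‖a‖ ^ 2 + ‖b‖ ^ 2 := by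
  rw [norm_mul, norm_mul, Complex.norm_ofNat]
  nlinarith [sq_nonneg (‖a‖ - ‖b‖)]

theorem mainTheorem10 (n : ℕ) (p : ℝ) (hp : 1 < p) (h g : Cn n → ℂ)
    (hh : DifferentiableOn ℂ h (unitBall n)) (hg : DifferentiableOn ℂ g (unitBall n))
    (hf : (fun z => h z + conj (g z)) ∈ bergmanClass n p)
    (h0 : (g 0 * h 0).re = 0) :
    IntegrableOn (fun z => (‖h z‖ ^ 2 + ‖g z‖ ^ 2) ^ (p / 2)) (unitBall n) ∧
    (∫ z in unitBall n, (‖h z‖ ^ 2 + ‖g z‖ ^ 2) ^ (p / 2)) ^ (1 / p)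
      ≤ 1 / rieszC₁ p * (∫ z in unitBall n, ‖h z + conj (g z)‖ ^ p) ^ (1 / p) ∧
    (∫ z in unitBall n, ‖h z + conj (g z)‖ ^ p) ^ (1 / p)
      ≤ rieszC₂ p * (∫ z in unitBall n, (‖h z‖ ^ 2 + ‖g z‖ ^ 2) ^ (p / 2)) ^ (1 / p) := by
  have hp0 : 0 < p := by linarith
  have hq : 1 / 2 < p / 2 := by linarith
  have hangle : critAngle (p / 2) = Real.pi / p := by
    rw [critAngle]; congr 1; ring
  have hG : DifferentiableOn ℂ (fun z => 2 * (g z * h z)) (unitBall n) :=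
    (hg.mul hh).const_mul 2
  have hG0 : ((2 : ℂ) * (g 0 * h 0)).re = 0 := by
    rw [Complex.mul_re, h0]; simp
  have hR0 : ∀ z, 0 ≤ ‖h z‖ ^ 2 + ‖g z‖ ^ 2 := fun z => by positivity
  have hRc : ContinuousOn (fun z => (‖h z‖ ^ 2 + ‖g z‖ ^ 2) ^ (p / 2)) (unitBall n) :=
    ((hh.continuousOn.norm.pow 2).add (hg.continuousOn.norm.pow 2)).rpow_const
      fun _ _ => Or.inr (by positivity)
  have hfc : ContinuousOn (fun z => ‖h z + conj (g z)‖ ^ p) (unitBall n) :=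
    (hh.continuousOn.add (Complex.continuous_conj.comp_continuousOn hg.continuousOn)).norm.rpow_const
      fun _ _ => Or.inr hp0.le
  have hC₁ : (1 - |Real.cos (Real.pi / p)|) ^ (p / 2) = rieszC₁ p ^ p :=
    (sqrt_rpow_eq (sub_nonneg.2 (abs_cos_pi_div_lt_one hp).le) p).symm
  have hC₂ : (1 + |Real.cos (Real.pi / p)|) ^ (p / 2) = rieszC₂ p ^ p := by
    rw [rieszC₂_eq hp, sqrt_rpow_eq (by positivity)]
  have hC₁0 := rieszC₁_pos hp
  have hC₂0 : 0 ≤ rieszC₂ p := by rw [rieszC₂_eq hp]; positivity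
  obtain ⟨ψ₁, hψ₁, hψ₁0, hψ₁le⟩ := exists_support_le_rpow hq
  obtain ⟨ψ₂, hψ₂, hψ₂0, hψ₂le⟩ := exists_support_rpow_le hq
  rw [hangle, hC₁] at hψ₁le
  rw [hangle, hC₂] at hψ₂le
  obtain ⟨hint₁, hle₁⟩ := integrableOn_and_integral_le_of_add_support_le hψ₁ hG (hψ₁0 _ hG0)
    (A := fun z => rieszC₁ p ^ p * (‖h z‖ ^ 2 + ‖g z‖ ^ 2) ^ (p / 2))
    (continuousOn_const.mul hRc) (fun z => by positivity) (fun z => by positivity) hf.2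
    fun z => by
      rw [norm_add_conj_rpow]
      exact hψ₁le _ _ (norm_two_mul_le (h z) (g z))
  have hint : IntegrableOn (fun z => (‖h z‖ ^ 2 + ‖g z‖ ^ 2) ^ (p / 2)) (unitBall n) := by
    refine (hint₁.const_mul (rieszC₁ p ^ p)⁻¹).congr (.of_forall fun z => ?_)
    exact inv_mul_cancel_left₀ (Real.rpow_pos_of_pos hC₁0 p).ne' _
  -- The majorant is integrable thanks to the first estimate, so the order of the two applications
  -- matters.
  obtain ⟨-, hle₂⟩ := integrableOn_and_integral_le_of_add_support_le hψ₂ hG (hψ₂0 _ hG0)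
    (A := fun z => ‖h z + conj (g z)‖ ^ p)
    (B := fun z => rieszC₂ p ^ p * (‖h z‖ ^ 2 + ‖g z‖ ^ 2) ^ (p / 2))
    hfc (fun z => by positivity) (fun z => by positivity) (hint.const_mul _)
    fun z => by
      rw [norm_add_conj_rpow]
      exact hψ₂le _ _ (norm_two_mul_le (h z) (g z))
  rw [integral_const_mul] at hle₁ hle₂
  have hX : 0 ≤ ∫ z in unitBall n, (‖h z‖ ^ 2 + ‖g z‖ ^ 2) ^ (p / 2) :=
    integral_nonneg fun z => by positivity
  have hY : 0 ≤ ∫ z in unitBall n, ‖h z + conj (g z)‖ ^ p := integral_nonneg fun z => by positivity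
  have hroot : ∀ {k X : ℝ}, 0 ≤ k → 0 ≤ X → (k ^ p * X) ^ (1 / p) = k * X ^ (1 / p) := by
    intro k X hk hX
    rw [Real.mul_rpow (by positivity) hX, one_div, Real.rpow_rpow_inv hk hp0.ne']
  refine ⟨hint, ?_, ?_⟩
  · have := Real.rpow_le_rpow (by positivity) hle₁ (one_div_nonneg.2 hp0.le)
    rw [hroot hC₁0.le hX] at this
    rwa [one_div_mul_eq_div, le_div_iff₀' hC₁0]
  · have := Real.rpow_le_rpow hY hle₂ (one_div_nonneg.2 hp0.le)
    rwa [hroot hC₂0 hX] at this
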